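/- Let $n\ge 1$ and let $\mathcal T=\{(i_1,j_1),\ldots,(i_{n-1},j_{n-1})\}$ be the set of oriented edges of a directed tree on the vertex set $\{1,\ldots,n\}$ (a tree each of whose edges is given exactly one, arbitrary, orientation). For an ordered set partition $(S_1,\ldots,S_k)$ of $\{1,\ldots,n\}$ (a sequence of nonempty, pairwise disjoint blocks with union $\{1,\ldots,n\}$), the associated plate is the cone $$\pi=[S_1,\ldots,S_k]=\Big\{x\in\mathbb R^n:\ \sum_{i\in S_1\cup\cdots\cup S_m}x_i\ge 0\ \text{ for } m=1,\ldots,k-1,\ \text{ and }\ \sum_{i=1}^n x_i=0\Big\},$$ and $\operatorname{len}(\pi)=k$. Let $[U]:\mathbb R^n\to\mathbb C$ denote the characteristic function of $U\subseteq\mathbb R^n$, let $\hat{\mathcal P}^n$ be the complex linear span of the characteristic functions of all plates, let $e_1,\ldots,e_n$ be the standard basis of $\mathbb R^n$, and let $\langle v_1,\ldots,v_r\rangle_+=\{\sum_a c_av_a: c_a\ge 0\}$ be the conical hull. Then $[\langle e_{i_1}-e_{j_1},\ldots,e_{i_{n-1}}-e_{j_{n-1}}\rangle_+]$ lies in $\hat{\mathcal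 P}^n$, and there $$[\langle e_{i_1}-e_{j_1},\ldots,e_{i_{n-1}}-e_{j_{n-1}}\rangle_+]=\sum_{\pi:\,p_{i_a}<p_{j_a}\ \forall a}(-1)^{n-\operatorname{len}(\pi)}[\pi],$$ where the sum runs over all plates $\pi$ (that is, over all ordered set partitions of $\{1,\ldots,n\}$) such that for every edge $(i_a,j_a)$ of $\mathcal T$ the block containing $i_a$ is strictly to the left of the block containing $j_a$. -/

import Mathlib

/-- An ordered set partition `(S_1, …, S_k)` of `{1, …, n}` (modelled by `Fin n`):
a finite sequence of nonempty, pairwise disjoint blocks covering everything. -/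
@[ext]
structure OrderedSetPartition (n : ℕ) where
  /-- the number of blocks -/
  len : ℕ
  /-- the sequence of blocks -/
  block : Fin len → Finset (Fin n)
  nonempty : ∀ s, (block s).Nonempty
  disjoint : ∀ s t, s ≠ t → Disjoint (block s) (block t)
  cover : ∀ i, ∃ s, i ∈ block s

namespace OrderedSetPartition

variable {n : ℕ}

theorem len_le (π : OrderedSetPartition n) : π.len ≤ n := by
  choose f hf using π.nonempty
  have hinj : Function.Injective f := by
    intro s t h
    by_contra hst
    exact Finset.disjoint_left.mp (π.disjoint s t hst) (hf s) (h ▸ hf t)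
  simpa using Fintype.card_le_of_injective f hinj

instance : Finite (OrderedSetPartition n) := by
  let g : OrderedSetPartition n → (Σ k : Fin (n + 1), Fin k → Finset (Fin n)) :=
    fun π => ⟨⟨π.len, Nat.lt_succ_of_le π.len_le⟩, π.block⟩
  refine Finite.of_injective g ?_
  rintro ⟨k, b, _, _, _⟩ ⟨l, c, _, _, _⟩ h
  simp only [g, Sigma.mk.injEq, Fin.mk.injEq] at h
  obtain ⟨rfl, h⟩ := h
  obtain rfl := eq_of_heq h
  rfl

noncomputable instance : Fintype (OrderedSetPartition n) := Fintype.ofFinite _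

/-- `p_i < p_j`: the block containing `i` lies strictly to the left of the block containing `j`. -/
def Precedes (π : OrderedSetPartition n) (i j : Fin n) : Prop :=
  ∃ s t : Fin π.len, s < t ∧ i ∈ π.block s ∧ j ∈ π.block t

instance (π : OrderedSetPartition n) (i j : Fin n) : Decidable (π.Precedes i j) :=
  inferInstanceAs (Decidable (∃ s t : Fin π.len, s < t ∧ i ∈ π.block s ∧ j ∈ π.block t))

/-- The plate `[S_1, …, S_k]`: the set of `x ∈ ℝⁿ` whose coordinates sum to zero and such that the
sum of the coordinates over `S_1 ∪ ⋯ ∪ S_m` is nonnegative for every `1 ≤ m ≤ k - 1`.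
(The block indices start at `0` here, so `S_1 ∪ ⋯ ∪ S_m` is the union of the blocks `s ≤ m - 1`.) -/
def plate (π : OrderedSetPartition n) : Set (Fin n → ℝ) :=
  {x | (∀ m : Fin π.len, (m : ℕ) + 1 < π.len →
          0 ≤ ∑ i ∈ (Finset.univ.filter (fun s => s ≤ m)).biUnion π.block, x i) ∧
        ∑ i, x i = 0}

end OrderedSetPartition

/-- The (complex-valued) characteristic function `[U]` of a subset `U` of `ℝⁿ`. -/
noncomputable def charFn {n : ℕ} (U : Set (Fin n → ℝ)) : (Fin n → ℝ) → ℂ :=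
  U.indicator (fun _ => 1)

/-- The complex linear span of the characteristic functions of all plates. -/
noncomputable def plateSpace (n : ℕ) : Submodule ℂ ((Fin n → ℝ) → ℂ) :=
  Submodule.span ℂ (Set.range fun π : OrderedSetPartition n => charFn π.plate)

/-- `E` is the set of oriented edges of a directed tree on the vertex set `{1, …, n}`: each
undirected edge carries exactly one orientation (in particular there are no loops), and the
underlying undirected graph is a tree. -/
def IsDirectedTree {n : ℕ} (E : Finset (Fin n × Fin n)) : Prop :=
  (∀ i j, (i, j) ∈ E → (j, i) ∉ E) ∧
    (SimpleGraph.fromRel (fun i j => (i, j) ∈ E)).IsTree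

/-- The root `e_i - e_j` of an oriented edge `(i, j)`. -/
def root {n : ℕ} (e : Fin n × Fin n) : Fin n → ℝ :=
  Pi.single e.1 1 - Pi.single e.2 1

/-- The conical hull of a finite family of vectors: all their linear combinations with
nonnegative coefficients. -/
def conicalHull {n : ℕ} {ι : Type*} [Fintype ι] (v : ι → Fin n → ℝ) : Set (Fin n → ℝ) :=
  {x | ∃ c : ι → ℝ, (∀ a, 0 ≤ c a) ∧ x = ∑ a, c a • v a}

/-- The cone `⟨e_i - e_j : (i, j) ∈ E⟩₊` encoded by a set of oriented edges. -/
def edgeCone {n : ℕ} (E : Finset (Fin n × Fin n)) : Set (Fin n → ℝ) :=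
  conicalHull (fun e : E => root (e : Fin n × Fin n))

/-! Unions of initial blocks turn an ordered set partition into a chain of subsets from ∅ to the
whole vertex set, with one member more than there are blocks. At a point x of coordinate sum zero,
the alternating sum of plates thus becomes `signedCount`: a signed count of the chains that separate
every edge and on whose members x has nonnegative sums. Its exponent has the parity of n - len. That
this count is 1 on the cone and 0 off it (`GrownTree.signedCount_eq`) follows by induction on the
tree, removing a leaf v with neighbour u.

Let the edge be (v, u). Then x lies in the cone iff x v ≥ 0 and x - x v • (e_v - e_u) lies in the
cone of the smaller tree (`mem_edgeCone_insert`), and the count obeys the same recursion. If x v <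
0, let B be the smallest member containing v: toggling B \ {v} reverses signs and cancels
everything. If x v ≥ 0, let A be the largest member avoiding v: toggling A ∪ {v} cancels all chains
except the tight ones, where A ∪ {v} is the only member containing v but not u. In a tight chain
every other member contains both of u, v or neither, so deleting v gives a bijection with the chains
of the smaller tree, the weight of v passing to u (`sum_attach`).

A sink leaf becomes a source leaf after complementing all sets, reversing all edges and negating x
(`signedCount_image_swap`). -/

/-- A flag of subsets of `W`, containing `∅` and `W`. -/
structure IsFlag {n : ℕ} (W : Finset (Fin n)) (𝓕 : Finset (Finset (Fin n))) : Prop where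
  subset : ∀ F ∈ 𝓕, F ⊆ W
  empty_mem : ∅ ∈ 𝓕
  top_mem : W ∈ 𝓕
  chain : ∀ F ∈ 𝓕, ∀ G ∈ 𝓕, F ⊆ G ∨ G ⊆ F

/-- The flag separates the two ends of every edge, the source coming first. -/
def Separates {n : ℕ} (𝓕 : Finset (Finset (Fin n))) (E : Finset (Fin n × Fin n)) : Prop :=
  ∀ e ∈ E, ∃ F ∈ 𝓕, e.1 ∈ F ∧ e.2 ∉ F

open Classical in
/-- The flags of `W` that separate the edges of `E` and on all of whose members `x` has a
nonnegative sum. -/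
noncomputable def admissible {n : ℕ} (W : Finset (Fin n)) (E : Finset (Fin n × Fin n))
    (x : Fin n → ℝ) : Finset (Finset (Finset (Fin n))) :=
  Finset.univ.filter fun 𝓕 => IsFlag W 𝓕 ∧ Separates 𝓕 E ∧ ∀ F ∈ 𝓕, 0 ≤ ∑ i ∈ F, x i

/-- The signed count of admissible flags. -/
noncomputable def signedCount {n : ℕ} (W : Finset (Fin n)) (E : Finset (Fin n × Fin n))
    (x : Fin n → ℝ) : ℤ :=
  ∑ 𝓕 ∈ admissible W E x, (-1) ^ (W.card + 1 + 𝓕.card)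

/-! ### Flags: toggling a member, and the members adjacent to a vertex -/

section Flags

variable {n : ℕ} {W : Finset (Fin n)} {E : Finset (Fin n × Fin n)} {x : Fin n → ℝ}
  {𝓕 : Finset (Finset (Fin n))} {u v : Fin n}

theorem mem_admissible :
    𝓕 ∈ admissible W E x ↔
      IsFlag W 𝓕 ∧ Separates 𝓕 E ∧ ∀ F ∈ 𝓕, 0 ≤ ∑ i ∈ F, x i := by
  simp [admissible]

/-- Remove `C` from the family if it is there, add it otherwise. -/
def toggle (𝓕 : Finset (Finset (Fin n))) (C : Finset (Fin n)) : Finset (Finset (Fin n)) :=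
  if C ∈ 𝓕 then 𝓕.erase C else insert C 𝓕

theorem mem_toggle_of_ne {C F : Finset (Fin n)} (h : F ≠ C) : F ∈ toggle 𝓕 C ↔ F ∈ 𝓕 := by
  unfold toggle; split_ifs <;> simp [h]

theorem toggle_subset_insert (C : Finset (Fin n)) : toggle 𝓕 C ⊆ insert C 𝓕 := by
  intro F; unfold toggle; split_ifs
  · intro h; exact Finset.mem_insert_of_mem (Finset.mem_of_mem_erase h)
  · exact id

theorem toggle_toggle (C : Finset (Fin n)) : toggle (toggle 𝓕 C) C = 𝓕 := by
  by_cases h : C ∈ 𝓕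
  · simp [toggle, h, Finset.insert_erase]
  · simp [toggle, h]

theorem toggle_ne (C : Finset (Fin n)) : toggle 𝓕 C ≠ 𝓕 := by
  by_cases h : C ∈ 𝓕
  · simp [toggle, h]
  · simp [toggle, h]

theorem sign_add_sign_toggle (C : Finset (Fin n)) (k : ℕ) :
    (-1 : ℤ) ^ (k + 𝓕.card) + (-1) ^ (k + (toggle 𝓕 C).card) = 0 := by
  by_cases h : C ∈ 𝓕
  · rw [toggle, if_pos h, ← Finset.card_erase_add_one h]; ring
  · rw [toggle, if_neg h, Finset.card_insert_of_notMem h]; ring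

theorem Separates.exists_insert (h : Separates 𝓕 (insert (v, u) E)) :
    ∃ F ∈ 𝓕, v ∈ F ∧ u ∉ F :=
  h _ (Finset.mem_insert_self _ _)

/-- The largest member of a flag that does not contain `v`. -/
def below (𝓕 : Finset (Finset (Fin n))) (v : Fin n) : Finset (Fin n) :=
  (𝓕.filter (v ∉ ·)).biUnion id

theorem notMem_below : v ∉ below 𝓕 v := by simp +contextual [below]

theorem subset_below {F : Finset (Fin n)} (hF : F ∈ 𝓕) (hv : v ∉ F) : F ⊆ below 𝓕 v :=
  fun i hi => by simp only [below, Finset.mem_biUnion, Finset.mem_filter]; exact ⟨F, ⟨hF, hv⟩, hi⟩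

theorem below_eq {A : Finset (Fin n)} (hA : A ∈ 𝓕) (hv : v ∉ A)
    (h : ∀ F ∈ 𝓕, v ∉ F → F ⊆ A) : below 𝓕 v = A := by
  refine Finset.Subset.antisymm ?_ (subset_below hA hv)
  intro i hi
  simp only [below, Finset.mem_biUnion, Finset.mem_filter] at hi
  obtain ⟨F, ⟨hF, hvF⟩, hi⟩ := hi
  exact h F hF hvF hi

theorem IsFlag.below_mem (h : IsFlag W 𝓕) (v : Fin n) : below 𝓕 v ∈ 𝓕 := by
  obtain ⟨A, hA, hmax⟩ := Finset.exists_max_image (𝓕.filter (v ∉ ·)) Finset.card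
    ⟨∅, by simp [h.empty_mem]⟩
  rw [Finset.mem_filter] at hA
  rw [below_eq hA.1 hA.2]
  · exact hA.1
  · intro F hF hv
    rcases h.chain F hF A hA.1 with h1 | h1
    · exact h1
    · exact (Finset.eq_of_subset_of_card_le h1 (hmax F (by simp [hF, hv]))).ge

theorem IsFlag.below_subset (h : IsFlag W 𝓕) {F : Finset (Fin n)} (hF : F ∈ 𝓕) (hv : v ∈ F) :
    below 𝓕 v ⊆ F := by
  rcases h.chain F hF _ (h.below_mem v) with h1 | h1
  · exact absurd (h1 hv) notMem_below
  · exact h1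

/-- Only members avoiding `v` enter `below`. Hence toggling `insert v (below 𝓕 v)` does not change
which set is toggled, and is an involution. -/
theorem below_toggle {C : Finset (Fin n)} (hv : v ∈ C) : below (toggle 𝓕 C) v = below 𝓕 v := by
  unfold below
  congr 1
  ext F
  simp only [Finset.mem_filter]
  refine and_congr_left fun h => mem_toggle_of_ne ?_
  rintro rfl
  exact h hv

/-- The smallest member of a flag that contains `v`. -/
def above (𝓕 : Finset (Finset (Fin n))) (v : Fin n) : Finset (Fin n) :=
  Finset.univ.filter fun i => ∀ F ∈ 𝓕, v ∈ F → i ∈ F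

theorem mem_above : v ∈ above 𝓕 v := by simp +contextual [above]

theorem above_subset {F : Finset (Fin n)} (hF : F ∈ 𝓕) (hv : v ∈ F) : above 𝓕 v ⊆ F := by
  intro i hi
  simp only [above, Finset.mem_filter, Finset.mem_univ, true_and] at hi
  exact hi F hF hv

theorem IsFlag.above_mem (h : IsFlag W 𝓕) (hv : v ∈ W) : above 𝓕 v ∈ 𝓕 := by
  obtain ⟨A, hA, hmin⟩ := Finset.exists_min_image (𝓕.filter (v ∈ ·)) Finset.card
    ⟨W, by simp [h.top_mem, hv]⟩
  rw [Finset.mem_filter] at hA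
  have : above 𝓕 v = A := by
    refine Finset.Subset.antisymm (above_subset hA.1 hA.2) ?_
    intro i hi
    simp only [above, Finset.mem_filter, Finset.mem_univ, true_and]
    intro F hF hvF
    rcases h.chain F hF A hA.1 with h1 | h1
    · rw [Finset.eq_of_subset_of_card_le h1 (hmin F (by simp [hF, hvF]))]; exact hi
    · exact h1 hi
  rw [this]; exact hA.1

theorem IsFlag.subset_above (h : IsFlag W 𝓕) (hvW : v ∈ W) {F : Finset (Fin n)} (hF : F ∈ 𝓕)
    (hv : v ∉ F) : F ⊆ above 𝓕 v := by
  rcases h.chain F hF _ (h.above_mem hvW) with h1 | h1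
  · exact h1
  · exact absurd (h1 mem_above) hv

theorem above_toggle {C : Finset (Fin n)} (hv : v ∉ C) : above (toggle 𝓕 C) v = above 𝓕 v := by
  unfold above
  ext i
  simp only [Finset.mem_filter, Finset.mem_univ, true_and]
  refine forall_congr' fun F => ?_
  by_cases h : F = C
  · subst h; simp [hv]
  · rw [mem_toggle_of_ne h]

/-- Toggling a set which is comparable to all members of a flag yields a flag. -/
theorem IsFlag.toggle (h : IsFlag W 𝓕) {C : Finset (Fin n)} (hC : C ⊆ W) (h0 : C ≠ ∅) (h1 : C ≠ W)
    (hc : ∀ F ∈ 𝓕, F ⊆ C ∨ C ⊆ F) : IsFlag W (toggle 𝓕 C) where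
  subset F hF := by
    rcases Finset.mem_insert.1 (toggle_subset_insert C hF) with rfl | hF
    · exact hC
    · exact h.subset F hF
  empty_mem := (mem_toggle_of_ne h0.symm).2 h.empty_mem
  top_mem := (mem_toggle_of_ne h1.symm).2 h.top_mem
  chain F hF G hG := by
    rcases Finset.mem_insert.1 (toggle_subset_insert C hF) with hF | hF <;>
    rcases Finset.mem_insert.1 (toggle_subset_insert C hG) with hG | hG
    · exact Or.inl (hF.trans hG.symm).subset
    · rw [hF]; exact (hc G hG).symm
    · rw [hG]; exact hc F hF
    · exact h.chain F hF G hG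

/-! ### Cancellation at a source leaf -/

/-- If a source leaf carries a negative weight, the admissible flags cancel. -/
theorem signedCount_insert_of_neg (hv : v ∉ W) (hu : u ∈ W)
    (hE : ∀ e ∈ E, e.1 ∈ W ∧ e.2 ∈ W) (hx : x v < 0) :
    signedCount (insert v W) (insert (v, u) E) x = 0 := by
  have huv : u ≠ v := fun h => hv (h ▸ hu)
  refine Finset.sum_involution (fun 𝓕 _ => toggle 𝓕 ((above 𝓕 v).erase v)) ?_ ?_ ?_ ?_
  · intro 𝓕 _
    exact sign_add_sign_toggle _ _
  · intro 𝓕 _ _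
    exact toggle_ne _
  · intro 𝓕 h
    rw [mem_admissible] at h ⊢
    obtain ⟨hf, hs, hp⟩ := h
    have hvW : v ∈ insert v W := Finset.mem_insert_self _ _
    have hB := hf.above_mem hvW
    set B := above 𝓕 v with hBdef
    have hvB : v ∈ B := mem_above
    have hsum := hp B hB
    rw [← Finset.add_sum_erase _ _ hvB] at hsum
    -- If `B` were `{v}`, its sum would be `x v < 0`.
    have hne : B.erase v ≠ ∅ := by
      intro h0
      rw [h0] at hsum
      simp at hsum
      linarith
    refine ⟨hf.toggle ((Finset.erase_subset _ _).trans (hf.subset B hB)) hne ?_ ?_, ?_, ?_⟩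
    · intro h
      have := Finset.notMem_erase v B
      rw [h] at this
      exact this hvW
    · intro F hF
      by_cases hvF : v ∈ F
      · exact Or.inr ((Finset.erase_subset _ _).trans (above_subset hF hvF))
      · left
        intro i hi
        exact Finset.mem_erase.2 ⟨fun h => hvF (h ▸ hi), hf.subset_above hvW hF hvF hi⟩
    · have key : ∀ e ∈ insert (v, u) E, e.2 ≠ v := by
        intro e he
        rcases Finset.mem_insert.1 he with rfl | he
        · exact huv
        · exact fun h => hv (h ▸ (hE e he).2)
      intro e he
      obtain ⟨F, hF, h1, h2⟩ := hs e he
      -- If the toggled set separated `e`, then `B`, which stays in the flag, still does, because no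
      -- edge ends at `v`.
      by_cases hFC : F = B.erase v
      · refine ⟨B, (mem_toggle_of_ne ?_).2 hB, ?_, ?_⟩
        · intro h
          exact Finset.notMem_erase v B (h ▸ hvB)
        · subst hFC; exact Finset.mem_of_mem_erase h1
        · subst hFC
          exact fun h => h2 (Finset.mem_erase.2 ⟨key e he, h⟩)
      · exact ⟨F, (mem_toggle_of_ne hFC).2 hF, h1, h2⟩
    · intro F hF
      rcases Finset.mem_insert.1 (toggle_subset_insert _ hF) with rfl | hF
      -- Dropping the negative weight `x v` from `B` only increases the sum.
      · linarith
      · exact hp F hF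
  · intro 𝓕 _
    rw [above_toggle (Finset.notMem_erase _ _), toggle_toggle]

/-- The only member of the flag with `v` before and `u` after it is the one directly following
`below 𝓕 v`. -/
def IsTight (u v : Fin n) (𝓕 : Finset (Finset (Fin n))) : Prop :=
  ∀ G ∈ 𝓕, v ∈ G → u ∉ G → G = insert v (below 𝓕 v)

open Classical in
/-- If a source leaf carries a nonnegative weight, the flags that are not tight cancel. -/
theorem sum_not_isTight (hv : v ∉ W) (hu : u ∈ W)
    (hE : ∀ e ∈ E, e.1 ∈ W ∧ e.2 ∈ W) (hx : 0 ≤ x v) :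
    ∑ 𝓕 ∈ (admissible (insert v W) (insert (v, u) E) x).filter (fun 𝓕 => ¬ IsTight u v 𝓕),
      (-1 : ℤ) ^ ((insert v W).card + 1 + 𝓕.card) = 0 := by
  have huv : u ≠ v := fun h => hv (h ▸ hu)
  refine Finset.sum_involution (fun 𝓕 _ => toggle 𝓕 (insert v (below 𝓕 v))) ?_ ?_ ?_ ?_
  · intro 𝓕 _
    exact sign_add_sign_toggle _ _
  · intro 𝓕 _ _
    exact toggle_ne _
  · intro 𝓕 h
    rw [Finset.mem_filter, mem_admissible] at h ⊢
    obtain ⟨⟨hf, hs, hp⟩, ht⟩ := h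
    have hA := hf.below_mem v
    have hbt : below (toggle 𝓕 (insert v (below 𝓕 v))) v = below 𝓕 v :=
      below_toggle (Finset.mem_insert_self _ _)
    set A := below 𝓕 v with hAdef
    have hvA : v ∉ A := notMem_below
    simp only [IsTight, not_forall] at ht
    -- `G` is a second member separating `v` from `u`. It survives the toggle, so the edge `(v, u)`
    -- stays separated and the flag stays non-tight.
    obtain ⟨G, hG, hvG, huG, hGA⟩ := ht
    have hAG : insert v A ⊆ G := Finset.insert_subset hvG (hf.below_subset hG hvG)
    have huA : u ∉ insert v A := fun h => huG (hAG h)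
    have hAne : A ≠ insert v A := fun h => hvA (by rw [h]; exact Finset.mem_insert_self _ _)
    refine ⟨⟨hf.toggle (Finset.insert_subset (Finset.mem_insert_self _ _) (hf.subset A hA))
      (Finset.insert_ne_empty _ _) ?_ ?_, ?_, ?_⟩, ?_⟩
    · intro h
      exact huA (h ▸ Finset.mem_insert_of_mem hu)
    · intro F hF
      by_cases hvF : v ∈ F
      · exact Or.inr (Finset.insert_subset hvF (hf.below_subset hF hvF))
      · exact Or.inl ((subset_below hF hvF).trans (Finset.subset_insert _ _))
    · intro e he
      rcases Finset.mem_insert.1 he with rfl | he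
      · exact ⟨G, (mem_toggle_of_ne hGA).2 hG, hvG, huG⟩
      · obtain ⟨F, hF, h1, h2⟩ := hs e (Finset.mem_insert_of_mem he)
        -- Edges of `E` do not start at `v`, so `A` separates whatever `insert v A` did.
        by_cases hFC : F = insert v A
        · refine ⟨A, (mem_toggle_of_ne hAne).2 hA, ?_, ?_⟩
          · subst hFC
            exact (Finset.mem_insert.1 h1).resolve_left fun h => hv (h ▸ (hE e he).1)
          · subst hFC
            exact fun h => h2 (Finset.mem_insert_of_mem h)
        · exact ⟨F, (mem_toggle_of_ne hFC).2 hF, h1, h2⟩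
    · intro F hF
      rcases Finset.mem_insert.1 (toggle_subset_insert _ hF) with rfl | hF
      · rw [Finset.sum_insert hvA]
        have := hp A hA
        linarith
      · exact hp F hF
    · simp only [IsTight, not_forall]
      refine ⟨G, (mem_toggle_of_ne hGA).2 hG, hvG, huG, ?_⟩
      rw [hbt]
      exact hGA
  · intro 𝓕 _
    rw [below_toggle (Finset.mem_insert_self _ _), toggle_toggle]

/-! ### Tight flags correspond to flags of the smaller tree -/

theorem sum_root_single {F : Finset (Fin n)} (i j : Fin n) :
    ∑ k ∈ F, root (i, j) k = (if i ∈ F then 1 else 0) - (if j ∈ F then 1 else 0) := by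
  simp [root, Finset.sum_sub_distrib]

/-- Attach `v` to the sets that contain `u`. -/
def attach (u v : Fin n) (G : Finset (Fin n)) : Finset (Fin n) :=
  if u ∈ G then insert v G else G

/-- The tight flag on `insert v W` extending a flag on `W`. -/
def extendFlag (u v : Fin n) (𝓖 : Finset (Finset (Fin n))) : Finset (Finset (Fin n)) :=
  insert (insert v (below 𝓖 u)) (𝓖.image (attach u v))

/-- As `v ∉ G`, the root `e_v - e_u` sums over `G` to -1 or 0 according as `u ∈ G` or not. The shift
thus adds `x v` exactly when `attach` adds `v`. -/
theorem sum_attach {G : Finset (Fin n)} (hv : v ∉ G) :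
    ∑ i ∈ attach u v G, x i = ∑ i ∈ G, (x - x v • root (v, u)) i := by
  have : ∑ i ∈ G, (x - x v • root (v, u)) i = ∑ i ∈ G, x i - x v * ∑ i ∈ G, root (v, u) i := by
    simp [Finset.sum_sub_distrib, Finset.mul_sum]
  rw [this, sum_root_single]
  unfold attach
  split_ifs with h
  · rw [Finset.sum_insert hv]; ring
  · simp

theorem erase_attach {G : Finset (Fin n)} (hv : v ∉ G) : (attach u v G).erase v = G := by
  unfold attach
  split_ifs <;> simp [hv]

theorem mem_attach {G : Finset (Fin n)} {i : Fin n} (hi : i ≠ v) : i ∈ attach u v G ↔ i ∈ G := by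
  unfold attach
  split_ifs <;> simp [hi]

theorem left_mem_attach {G : Finset (Fin n)} (hv : v ∉ G) : v ∈ attach u v G ↔ u ∈ G := by
  unfold attach
  split_ifs <;> simp [*]

theorem attach_mono {F G : Finset (Fin n)} (h : F ⊆ G) : attach u v F ⊆ attach u v G := by
  unfold attach
  split_ifs with h1 h2 h2
  · exact Finset.insert_subset_insert _ h
  · exact absurd (h h1) h2
  · exact h.trans (Finset.subset_insert _ _)
  · exact h

theorem attach_eq_self {G : Finset (Fin n)} (hu : u ∉ G) : attach u v G = G := if_neg hu

theorem attach_erase {F : Finset (Fin n)} (huv : u ≠ v) (h : v ∈ F ↔ u ∈ F) :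
    attach u v (F.erase v) = F := by
  unfold attach
  by_cases hv : v ∈ F
  · rw [if_pos (Finset.mem_erase.2 ⟨huv, h.1 hv⟩), Finset.insert_erase hv]
  · rw [if_neg fun hu => hv (h.2 (Finset.mem_of_mem_erase hu)), Finset.erase_eq_of_notMem hv]

section ExtendFlag

variable {𝓖 : Finset (Finset (Fin n))}

theorem attach_mem_extendFlag {G : Finset (Fin n)} (hG : G ∈ 𝓖) :
    attach u v G ∈ extendFlag u v 𝓖 :=
  Finset.mem_insert_of_mem (Finset.mem_image_of_mem _ hG)

theorem image_erase_extendFlag (h : IsFlag W 𝓖) (hv : v ∉ W) :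
    (extendFlag u v 𝓖).image (Finset.erase · v) = 𝓖 := by
  have hA := h.below_mem u
  rw [extendFlag, Finset.image_insert, Finset.erase_insert fun hh => hv (h.subset _ hA hh),
    Finset.image_image]
  have : 𝓖.image ((Finset.erase · v) ∘ attach u v) = 𝓖.image id :=
    Finset.image_congr fun G hG => erase_attach fun hh => hv (h.subset _ hG hh)
  rw [this, Finset.image_id, Finset.insert_eq_of_mem hA]

/-- The added set contains `v` but not `u`, whereas an attached set contains both or neither. -/
theorem card_extendFlag (h : IsFlag W 𝓖) (hv : v ∉ W) (huv : u ≠ v) :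
    (extendFlag u v 𝓖).card = 𝓖.card + 1 := by
  rw [extendFlag, Finset.card_insert_of_notMem, Finset.card_image_of_injOn]
  · intro F hF G hG hFG
    have := congrArg (Finset.erase · v) hFG
    simpa only [erase_attach fun hh => hv (h.subset _ hF hh),
      erase_attach fun hh => hv (h.subset _ hG hh)] using this
  · intro hh
    obtain ⟨G, hG, hGe⟩ := Finset.mem_image.1 hh
    have h1 : v ∈ attach u v G := by rw [hGe]; exact Finset.mem_insert_self _ _
    rw [left_mem_attach fun hh => hv (h.subset _ hG hh), ← mem_attach (v := v) huv, hGe,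
      Finset.mem_insert] at h1
    exact h1.elim huv notMem_below

theorem below_extendFlag (h : IsFlag W 𝓖) (hv : v ∉ W) :
    below (extendFlag u v 𝓖) v = below 𝓖 u := by
  have hA := h.below_mem u
  refine below_eq ?_ (fun hh => hv (h.subset _ hA hh)) ?_
  · have := attach_mem_extendFlag (u := u) (v := v) hA
    rwa [attach_eq_self notMem_below] at this
  · intro F hF hvF
    rcases Finset.mem_insert.1 hF with rfl | hF
    · exact absurd (Finset.mem_insert_self _ _) hvF
    · obtain ⟨G, hG, rfl⟩ := Finset.mem_image.1 hF
      rw [left_mem_attach fun hh => hv (h.subset _ hG hh)] at hvF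
      rw [attach_eq_self hvF]
      exact subset_below hG hvF

theorem isTight_extendFlag (h : IsFlag W 𝓖) (hv : v ∉ W) (huv : u ≠ v) :
    IsTight u v (extendFlag u v 𝓖) := by
  intro F hF hvF huF
  rw [below_extendFlag h hv]
  rcases Finset.mem_insert.1 hF with rfl | hF
  · rfl
  · obtain ⟨G, hG, rfl⟩ := Finset.mem_image.1 hF
    rw [left_mem_attach fun hh => hv (h.subset _ hG hh)] at hvF
    exact absurd ((mem_attach huv).2 hvF) huF

theorem extendFlag_mem_admissible (hv : v ∉ W) (hu : u ∈ W)
    (hE : ∀ e ∈ E, e.1 ∈ W ∧ e.2 ∈ W) (hx : 0 ≤ x v)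
    (h : 𝓖 ∈ admissible W E (x - x v • root (v, u))) :
    extendFlag u v 𝓖 ∈ admissible (insert v W) (insert (v, u) E) x := by
  have huv : u ≠ v := fun h => hv (h ▸ hu)
  rw [mem_admissible] at h ⊢
  obtain ⟨hf, hs, hp⟩ := h
  have hA := hf.below_mem u
  have hvA : v ∉ below 𝓖 u := fun hh => hv (hf.subset _ hA hh)
  have hsum : ∀ G ∈ 𝓖, 0 ≤ ∑ i ∈ attach u v G, x i := fun G hG => by
    rw [sum_attach fun hh => hv (hf.subset _ hG hh)]
    exact hp G hG
  have hcmp : ∀ G ∈ 𝓖, attach u v G ⊆ insert v (below 𝓖 u) ∨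
      insert v (below 𝓖 u) ⊆ attach u v G := by
    intro G hG
    by_cases huG : u ∈ G
    · right
      rw [attach, if_pos huG]
      exact Finset.insert_subset_insert _ (hf.below_subset hG huG)
    · left
      rw [attach_eq_self huG]
      exact (subset_below hG huG).trans (Finset.subset_insert _ _)
  refine ⟨⟨?_, ?_, ?_, ?_⟩, ?_, ?_⟩
  · intro F hF
    rcases Finset.mem_insert.1 hF with rfl | hF
    · exact Finset.insert_subset_insert _ (hf.subset _ hA)
    · obtain ⟨G, hG, rfl⟩ := Finset.mem_image.1 hF
      unfold attach
      split_ifs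
      · exact Finset.insert_subset_insert _ (hf.subset _ hG)
      · exact (hf.subset _ hG).trans (Finset.subset_insert _ _)
  · have := attach_mem_extendFlag (u := u) (v := v) hf.empty_mem
    rwa [attach_eq_self (Finset.notMem_empty _)] at this
  · have := attach_mem_extendFlag (u := u) (v := v) hf.top_mem
    rwa [attach, if_pos hu] at this
  · intro F hF G hG
    rcases Finset.mem_insert.1 hF with hF | hF <;> rcases Finset.mem_insert.1 hG with hG | hG
    · exact Or.inl (hF.trans hG.symm).subset
    · obtain ⟨G', hG', rfl⟩ := Finset.mem_image.1 hG
      rw [hF]; exact (hcmp G' hG').symm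
    · obtain ⟨F', hF', rfl⟩ := Finset.mem_image.1 hF
      rw [hG]; exact hcmp F' hF'
    · obtain ⟨F', hF', rfl⟩ := Finset.mem_image.1 hF
      obtain ⟨G', hG', rfl⟩ := Finset.mem_image.1 hG
      exact (hf.chain F' hF' G' hG').imp attach_mono attach_mono
  · intro e he
    rcases Finset.mem_insert.1 he with rfl | he
    · refine ⟨_, Finset.mem_insert_self _ _, Finset.mem_insert_self _ _, fun h => ?_⟩
      exact (Finset.mem_insert.1 h).elim huv notMem_below
    · obtain ⟨F, hF, h1, h2⟩ := hs e he
      refine ⟨_, attach_mem_extendFlag hF, (mem_attach fun h => hv ?_).2 h1,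
        fun hh => h2 ((mem_attach fun h => hv ?_).1 hh)⟩
      · exact h ▸ (hE e he).1
      · exact h ▸ (hE e he).2
  · intro F hF
    rcases Finset.mem_insert.1 hF with rfl | hF
    · rw [Finset.sum_insert hvA]
      -- The added set is the only member whose sum needs `0 ≤ x v`.
      have := hsum _ hA
      rw [attach_eq_self notMem_below] at this
      linarith
    · obtain ⟨G, hG, rfl⟩ := Finset.mem_image.1 hF
      exact hsum G hG

end ExtendFlag

section Tight

theorem IsTight.insert_mem (ht : IsTight u v 𝓕) (hs : Separates 𝓕 (insert (v, u) E)) :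
    insert v (below 𝓕 v) ∈ 𝓕 ∧ u ∉ insert v (below 𝓕 v) := by
  obtain ⟨G, hG, h1, h2⟩ := hs.exists_insert
  rw [← ht G hG h1 h2]
  exact ⟨hG, h2⟩

theorem IsTight.mem_iff (ht : IsTight u v 𝓕)
    (hs : Separates 𝓕 (insert (v, u) E)) {F : Finset (Fin n)} (hF : F ∈ 𝓕)
    (hne : F ≠ insert v (below 𝓕 v)) : v ∈ F ↔ u ∈ F := by
  constructor
  · intro hv
    by_contra hu
    exact hne (ht F hF hv hu)
  · intro hu
    by_contra hv
    exact (ht.insert_mem hs).2 (Finset.mem_insert_of_mem (subset_below hF hv hu))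

/-- Deleting and reattaching `v` fixes every member except `insert v (below 𝓕 v)`, which it sends to
`below 𝓕 v`. -/
theorem IsTight.attach_erase_mem (ht : IsTight u v 𝓕) (hf : IsFlag W 𝓕) (huv : u ≠ v)
    (hs : Separates 𝓕 (insert (v, u) E)) {F : Finset (Fin n)} (hF : F ∈ 𝓕) :
    attach u v (F.erase v) ∈ 𝓕 := by
  by_cases hne : F = insert v (below 𝓕 v)
  · rw [hne, Finset.erase_insert notMem_below, attach_eq_self]
    · exact hf.below_mem v
    · exact fun h => (ht.insert_mem hs).2 (Finset.mem_insert_of_mem h)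
  · rwa [attach_erase huv (ht.mem_iff hs hF hne)]

theorem IsTight.below_image (ht : IsTight u v 𝓕) (hf : IsFlag W 𝓕) (huv : u ≠ v)
    (hs : Separates 𝓕 (insert (v, u) E)) :
    below (𝓕.image (Finset.erase · v)) u = below 𝓕 v := by
  refine below_eq ?_ (fun h => (ht.insert_mem hs).2 (Finset.mem_insert_of_mem h)) ?_
  · exact Finset.mem_image.2 ⟨_, hf.below_mem v, Finset.erase_eq_of_notMem notMem_below⟩
  · intro F hF hu
    obtain ⟨G, hG, rfl⟩ := Finset.mem_image.1 hF
    have := ht.attach_erase_mem hf huv hs hG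
    rw [attach_eq_self hu] at this
    exact subset_below this (Finset.notMem_erase _ _)

theorem IsTight.extendFlag_image (ht : IsTight u v 𝓕) (hf : IsFlag W 𝓕) (huv : u ≠ v)
    (hs : Separates 𝓕 (insert (v, u) E)) :
    extendFlag u v (𝓕.image (Finset.erase · v)) = 𝓕 := by
  rw [extendFlag, ht.below_image hf huv hs]
  ext F
  rw [Finset.mem_insert, Finset.image_image, Finset.mem_image]
  constructor
  · rintro (rfl | ⟨G, hG, rfl⟩)
    · exact (ht.insert_mem hs).1
    · exact ht.attach_erase_mem hf huv hs hG
  · intro hF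
    by_cases hne : F = insert v (below 𝓕 v)
    · exact Or.inl hne
    · exact Or.inr ⟨F, hF, attach_erase huv (ht.mem_iff hs hF hne)⟩

theorem IsTight.image_mem_admissible (ht : IsTight u v 𝓕) (hv : v ∉ W) (hu : u ∈ W)
    (hE : ∀ e ∈ E, e.1 ∈ W ∧ e.2 ∈ W)
    (h : 𝓕 ∈ admissible (insert v W) (insert (v, u) E) x) :
    𝓕.image (Finset.erase · v) ∈ admissible W E (x - x v • root (v, u)) := by
  have huv : u ≠ v := fun h => hv (h ▸ hu)
  rw [mem_admissible] at h ⊢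
  obtain ⟨hf, hs, hp⟩ := h
  refine ⟨⟨?_, ?_, ?_, ?_⟩, ?_, ?_⟩
  · intro F hF
    obtain ⟨G, hG, rfl⟩ := Finset.mem_image.1 hF
    exact Finset.subset_insert_iff.1 (hf.subset G hG)
  · exact Finset.mem_image.2 ⟨∅, hf.empty_mem, Finset.erase_empty _⟩
  · exact Finset.mem_image.2 ⟨_, hf.top_mem, Finset.erase_insert hv⟩
  · intro F hF G hG
    obtain ⟨F', hF', rfl⟩ := Finset.mem_image.1 hF
    obtain ⟨G', hG', rfl⟩ := Finset.mem_image.1 hG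
    exact (hf.chain F' hF' G' hG').imp (Finset.erase_subset_erase _) (Finset.erase_subset_erase _)
  · intro e he
    obtain ⟨F, hF, h1, h2⟩ := hs e (Finset.mem_insert_of_mem he)
    refine ⟨_, Finset.mem_image_of_mem _ hF, Finset.mem_erase.2 ⟨fun h => hv ?_, h1⟩,
      fun hh => h2 (Finset.mem_of_mem_erase hh)⟩
    exact h ▸ (hE e he).1
  · intro F hF
    obtain ⟨G, hG, rfl⟩ := Finset.mem_image.1 hF
    rw [← sum_attach (Finset.notMem_erase _ _)]
    exact hp _ (ht.attach_erase_mem hf huv hs hG)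

end Tight

/-- A source leaf carrying a nonnegative weight can be removed, its weight being moved to its
neighbour. -/
theorem signedCount_insert_of_nonneg (hv : v ∉ W) (hu : u ∈ W)
    (hE : ∀ e ∈ E, e.1 ∈ W ∧ e.2 ∈ W) (hx : 0 ≤ x v) :
    signedCount (insert v W) (insert (v, u) E) x =
      signedCount W E (x - x v • root (v, u)) := by
  classical
  have huv : u ≠ v := fun h => hv (h ▸ hu)
  rw [signedCount, ← Finset.sum_filter_add_sum_filter_not _ (IsTight u v),
    sum_not_isTight hv hu hE hx, add_zero]
  refine Finset.sum_nbij' (fun 𝓕 => 𝓕.image (Finset.erase · v)) (extendFlag u v) ?_ ?_ ?_ ?_ ?_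
  · intro 𝓕 h
    rw [Finset.mem_filter] at h
    exact h.2.image_mem_admissible hv hu hE h.1
  · intro 𝓖 h
    rw [Finset.mem_filter]
    exact ⟨extendFlag_mem_admissible hv hu hE hx h,
      isTight_extendFlag (mem_admissible.1 h).1 hv huv⟩
  · intro 𝓕 h
    rw [Finset.mem_filter, mem_admissible] at h
    exact h.2.extendFlag_image h.1.1 huv h.1.2.1
  · intro 𝓖 h
    exact image_erase_extendFlag (mem_admissible.1 h).1 hv
  · intro 𝓕 h
    have hm := Finset.mem_filter.1 h
    have hG := hm.2.image_mem_admissible hv hu hE hm.1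
    have hF := mem_admissible.1 hm.1
    have hc := card_extendFlag (u := u) (mem_admissible.1 hG).1 hv huv
    rw [hm.2.extendFlag_image hF.1 huv hF.2.1] at hc
    -- Both the vertex set and the flag lose one element, so the sign is unchanged.
    rw [hc, Finset.card_insert_of_notMem hv]
    ring

end Flags

/-! ### Duality: complements and reversed edges -/

section Duality

variable {n : ℕ} {W : Finset (Fin n)} {E : Finset (Fin n × Fin n)} {x : Fin n → ℝ}
  {𝓕 : Finset (Finset (Fin n))}

theorem image_sdiff_mem_admissible (hE : ∀ e ∈ E, e.1 ∈ W ∧ e.2 ∈ W) (hx : ∑ i ∈ W, x i = 0)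
    (h : 𝓕 ∈ admissible W E x) :
    𝓕.image (W \ ·) ∈ admissible W (E.image Prod.swap) (-x) := by
  rw [mem_admissible] at h ⊢
  obtain ⟨hf, hs, hp⟩ := h
  refine ⟨⟨?_, ?_, ?_, ?_⟩, ?_, ?_⟩
  · intro F hF
    obtain ⟨G, hG, rfl⟩ := Finset.mem_image.1 hF
    exact Finset.sdiff_subset
  · exact Finset.mem_image.2 ⟨W, hf.top_mem, sdiff_self⟩
  · exact Finset.mem_image.2 ⟨∅, hf.empty_mem, Finset.sdiff_empty⟩
  · intro F hF G hG
    obtain ⟨F', hF', rfl⟩ := Finset.mem_image.1 hF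
    obtain ⟨G', hG', rfl⟩ := Finset.mem_image.1 hG
    exact (hf.chain G' hG' F' hF').imp (Finset.sdiff_subset_sdiff subset_rfl)
      (Finset.sdiff_subset_sdiff subset_rfl)
  · intro e he
    obtain ⟨e', he', rfl⟩ := Finset.mem_image.1 he
    obtain ⟨F, hF, h1, h2⟩ := hs e' he'
    refine ⟨_, Finset.mem_image_of_mem _ hF, ?_, ?_⟩
    · exact Finset.mem_sdiff.2 ⟨(hE e' he').2, h2⟩
    · exact fun h => (Finset.mem_sdiff.1 h).2 h1
  · intro F hF
    obtain ⟨G, hG, rfl⟩ := Finset.mem_image.1 hF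
    -- Since the total is zero, `-x` has on the complement of `G` the sum that `x` has on `G`.
    have h1 := Finset.sum_sdiff (f := x) (hf.subset G hG)
    have h2 := hp G hG
    simp only [Pi.neg_apply, Finset.sum_neg_distrib]
    linarith

theorem image_image_swap : (E.image Prod.swap).image Prod.swap = E := by
  simp [Finset.image_image]

/-- Complementation reverses all edges and negates the point. -/
theorem signedCount_image_swap (hE : ∀ e ∈ E, e.1 ∈ W ∧ e.2 ∈ W) (hx : ∑ i ∈ W, x i = 0) :
    signedCount W (E.image Prod.swap) (-x) = signedCount W E x := by
  have hE' : ∀ e ∈ E.image Prod.swap, e.1 ∈ W ∧ e.2 ∈ W := by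
    intro e he
    obtain ⟨e', he', rfl⟩ := Finset.mem_image.1 he
    exact (hE e' he').symm
  have hinv : ∀ {E' : Finset (Fin n × Fin n)} {y : Fin n → ℝ}, ∀ 𝓕 ∈ admissible W E' y,
      (𝓕.image (W \ ·)).image (W \ ·) = 𝓕 := by
    intro E' y 𝓕 h
    rw [Finset.image_image]
    conv_rhs => rw [← Finset.image_id (s := 𝓕)]
    refine Finset.image_congr fun F hF => ?_
    exact Finset.sdiff_sdiff_eq_self ((mem_admissible.1 h).1.subset F hF)
  refine Finset.sum_nbij' (fun 𝓕 => 𝓕.image (W \ ·)) (fun 𝓕 => 𝓕.image (W \ ·)) ?_ ?_ ?_ ?_ ?_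
  · intro 𝓕 h
    have := image_sdiff_mem_admissible hE' (by simp [hx]) h
    rwa [image_image_swap, neg_neg] at this
  · intro 𝓕 h
    exact image_sdiff_mem_admissible hE hx h
  · exact hinv
  · exact hinv
  · intro 𝓕 h
    rw [Finset.card_image_of_injOn]
    intro F hF G hG hFG
    have hs := (mem_admissible.1 h).1.subset
    have := congrArg (W \ ·) hFG
    simpa only [Finset.sdiff_sdiff_eq_self (hs F hF), Finset.sdiff_sdiff_eq_self (hs G hG)]
      using this

end Duality

/-! ### The cone of a tree with a leaf removed -/

section Cone

variable {n : ℕ} {W : Finset (Fin n)} {E : Finset (Fin n × Fin n)} {x : Fin n → ℝ}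
  {u v : Fin n}

theorem mem_edgeCone_iff :
    x ∈ edgeCone E ↔ ∃ c : Fin n × Fin n → ℝ, (∀ e ∈ E, 0 ≤ c e) ∧ x = ∑ e ∈ E, c e • root e := by
  constructor
  · rintro ⟨c, hc, rfl⟩
    refine ⟨fun e => if h : e ∈ E then c ⟨e, h⟩ else 0, fun e he => ?_, ?_⟩
    · simpa [he] using hc ⟨e, he⟩
    · rw [← Finset.sum_coe_sort E]
      simp
  · rintro ⟨c, hc, rfl⟩
    refine ⟨fun e => c e, fun e => hc e e.2, ?_⟩
    rw [← Finset.sum_coe_sort E]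

theorem sum_eq_zero_of_mem_edgeCone (h : x ∈ edgeCone E) : ∑ i, x i = 0 := by
  obtain ⟨c, -, rfl⟩ := mem_edgeCone_iff.1 h
  simp only [Finset.sum_apply, Pi.smul_apply, smul_eq_mul]
  rw [Finset.sum_comm]
  refine Finset.sum_eq_zero fun e _ => ?_
  rw [← Finset.mul_sum, sum_root_single]
  simp

/-- Membership in the cone when `e₀` is the only edge with a nonzero component at `v`. -/
theorem mem_edgeCone_insert {e₀ : Fin n × Fin n} (he₀ : e₀ ∉ E) {s : ℝ} (hs : s * s = 1)
    (h₀ : root e₀ v = s) (hE : ∀ e ∈ E, root e v = 0) :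
    x ∈ edgeCone (insert e₀ E) ↔ 0 ≤ s * x v ∧ x - (s * x v) • root e₀ ∈ edgeCone E := by
  simp only [mem_edgeCone_iff]
  constructor
  · rintro ⟨c, hc, hx⟩
    rw [Finset.sum_insert he₀] at hx
    -- Coordinate `v` sees only `e₀`. As `s` is its own inverse (1 for a source, -1 for a sink), `s
    -- * x v` recovers the coefficient.
    have hv : x v = c e₀ * s := by
      rw [hx]
      simp only [Pi.add_apply, Finset.sum_apply, Pi.smul_apply, smul_eq_mul, h₀]
      rw [Finset.sum_eq_zero fun e he => by rw [hE e he, mul_zero], add_zero]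
    have hc₀ : s * x v = c e₀ := by rw [hv]; linear_combination c e₀ * hs
    rw [hc₀]
    refine ⟨hc _ (Finset.mem_insert_self _ _), c, fun e he => hc e (Finset.mem_insert_of_mem he), ?_⟩
    rw [sub_eq_iff_eq_add, add_comm, ← hx]
  · rintro ⟨h0, c, hc, hx⟩
    refine ⟨fun e => if e = e₀ then s * x v else c e, fun e he => ?_, ?_⟩
    · by_cases h : e = e₀
      · simpa [h] using h0
      · simpa [h] using hc e ((Finset.mem_insert.1 he).resolve_left h)
    · have hrest : ∑ e ∈ E, (if e = e₀ then s * x v else c e) • root e = ∑ e ∈ E, c e • root e :=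
        Finset.sum_congr rfl fun e he => by rw [if_neg fun h : e = e₀ => he₀ (h ▸ he)]
      simp only [Finset.sum_insert he₀, if_true, hrest, ← hx, add_sub_cancel]

theorem root_apply_eq_zero (hv : v ∉ W) {e : Fin n × Fin n} (he : e.1 ∈ W ∧ e.2 ∈ W) :
    root e v = 0 := by
  have h1 : v ≠ e.1 := fun h => hv (h ▸ he.1)
  have h2 : v ≠ e.2 := fun h => hv (h ▸ he.2)
  simp [root, h1, h2]

theorem root_swap (u v : Fin n) : root (u, v) = -root (v, u) := by
  simp [root]

end Cone

/-! ### Induction over trees grown leaf by leaf -/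

/-- Oriented trees, grown by attaching one leaf at a time. -/
inductive GrownTree {n : ℕ} : Finset (Fin n) → Finset (Fin n × Fin n) → Prop
  | single (v : Fin n) : GrownTree {v} ∅
  | source {W : Finset (Fin n)} {E : Finset (Fin n × Fin n)} {u v : Fin n} (hv : v ∉ W)
      (hu : u ∈ W) (h : GrownTree W E) : GrownTree (insert v W) (insert (v, u) E)
  | sink {W : Finset (Fin n)} {E : Finset (Fin n × Fin n)} {u v : Fin n} (hv : v ∉ W)
      (hu : u ∈ W) (h : GrownTree W E) : GrownTree (insert v W) (insert (u, v) E)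

namespace GrownTree

variable {n : ℕ} {W : Finset (Fin n)} {E : Finset (Fin n × Fin n)}

theorem mem_of_mem (h : GrownTree W E) : ∀ e ∈ E, e.1 ∈ W ∧ e.2 ∈ W := by
  induction h with
  | single v => simp
  | source hv hu h ih =>
    intro e he
    rcases Finset.mem_insert.1 he with rfl | he
    · simp [hu]
    · simp [ih e he]
  | sink hv hu h ih =>
    intro e he
    rcases Finset.mem_insert.1 he with rfl | he
    · simp [hu]
    · simp [ih e he]

theorem card_add_one (h : GrownTree W E) : E.card + 1 = W.card := by
  induction h with
  | single v => simp
  | source hv hu h ih =>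
    rw [Finset.card_insert_of_notMem hv, ← ih, Finset.card_insert_of_notMem]
    exact fun he => hv (h.mem_of_mem _ he).1
  | sink hv hu h ih =>
    rw [Finset.card_insert_of_notMem hv, ← ih, Finset.card_insert_of_notMem]
    exact fun he => hv (h.mem_of_mem _ he).2

theorem signedCount_single (v : Fin n) {x : Fin n → ℝ} (hx : x v = 0) :
    signedCount {v} ∅ x = 1 := by
  have : admissible {v} ∅ x = {{∅, {v}}} := by
    ext 𝓕
    rw [mem_admissible, Finset.mem_singleton]
    constructor
    · rintro ⟨hf, -, -⟩
      refine Finset.Subset.antisymm (fun F hF => ?_) ?_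
      · simpa [Finset.subset_singleton_iff] using hf.subset F hF
      · simp [Finset.insert_subset_iff, hf.empty_mem, hf.top_mem]
    · rintro rfl
      refine ⟨⟨?_, by simp, by simp, ?_⟩, by simp [Separates], by simp [hx]⟩
      · simp
      · simp
  rw [signedCount, this, Finset.sum_singleton, Finset.card_pair (by simp)]
  simp

open Classical in
/-- The signed count of admissible flags is the characteristic function of the edge cone. -/
theorem signedCount_eq (h : GrownTree W E) :
    ∀ x : Fin n → ℝ, (∀ i ∉ W, x i = 0) → ∑ i ∈ W, x i = 0 →
      signedCount W E x = if x ∈ edgeCone E then 1 else 0 := by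
  induction h with
  | single v =>
    intro x hW hx
    rw [Finset.sum_singleton] at hx
    have hx0 : x = 0 := by
      funext i
      by_cases hi : i = v
      · rw [hi, hx]; rfl
      · exact hW i (by simpa using hi)
    rw [signedCount_single v hx, if_pos]
    rw [mem_edgeCone_iff]
    exact ⟨0, by simp, by simpa using hx0⟩
  | @source W E u v hv hu h ih =>
    intro x hW hx
    have hE := h.mem_of_mem
    have huv : u ≠ v := fun h => hv (h ▸ hu)
    have hc := mem_edgeCone_insert (x := x) (v := v) (e₀ := (v, u)) (E := E) (s := 1)
      (fun he => hv (hE _ he).1) (by norm_num) (by simp [root, huv.symm])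
      (fun e he => root_apply_eq_zero hv (hE e he))
    rw [one_mul] at hc
    by_cases h0 : 0 ≤ x v
    · rw [signedCount_insert_of_nonneg hv hu hE h0, ih, hc]
      · simp [h0]
      · intro i hi
        by_cases hiv : i = v
        · subst hiv
          simp [root, huv.symm]
        · have hiu : i ≠ u := fun h => hi (h ▸ hu)
          simp [root, hiv, hiu, hW i (by simp [hiv, hi])]
      · rw [Finset.sum_insert hv] at hx
        simp only [Pi.sub_apply, Pi.smul_apply, smul_eq_mul, Finset.sum_sub_distrib,
          ← Finset.mul_sum, sum_root_single, if_neg hv, if_pos hu]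
        linarith
    · rw [signedCount_insert_of_neg hv hu hE (not_le.1 h0), if_neg fun h => h0 (hc.1 h).1]
  | @sink W E u v hv hu h ih =>
    intro x hW hx
    have hE := h.mem_of_mem
    have huv : u ≠ v := fun h => hv (h ▸ hu)
    have hc := mem_edgeCone_insert (x := x) (v := v) (e₀ := (u, v)) (E := E) (s := -1)
      (fun he => hv (hE _ he).2) (by norm_num) (by simp [root, huv.symm])
      (fun e he => root_apply_eq_zero hv (hE e he))
    have hc' : x - (-1 * x v) • root (u, v) = x - x v • root (v, u) := by
      rw [root_swap]; simp
    rw [hc'] at hc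
    have hEs : ∀ e ∈ E.image Prod.swap, e.1 ∈ W ∧ e.2 ∈ W := by
      intro e he
      obtain ⟨e', he', rfl⟩ := Finset.mem_image.1 he
      exact (hE e' he').symm
    -- After dualizing, `v` is a source leaf of weight `-x v`. Once it is removed, dualizing back
    -- makes the induction hypothesis for `E` applicable.
    rw [← signedCount_image_swap (GrownTree.sink hv hu h).mem_of_mem hx, Finset.image_insert,
      Prod.swap_prod_mk]
    by_cases h0 : x v ≤ 0
    · have hsum : ∑ i ∈ W, (x - x v • root (v, u)) i = 0 := by
        rw [Finset.sum_insert hv] at hx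
        simp only [Pi.sub_apply, Pi.smul_apply, smul_eq_mul, Finset.sum_sub_distrib,
          ← Finset.mul_sum, sum_root_single, if_neg hv, if_pos hu]
        linarith
      have hneg : -x - (-x) v • root (v, u) = -(x - x v • root (v, u)) := by
        simp only [Pi.neg_apply, neg_smul]; abel
      rw [signedCount_insert_of_nonneg hv hu hEs (by simpa using h0), hneg,
        signedCount_image_swap hE hsum, ih _ ?_ hsum, hc]
      · simp [h0]
      · intro i hi
        by_cases hiv : i = v
        · subst hiv
          simp [root, huv.symm]
        · have hiu : i ≠ u := fun h => hi (h ▸ hu)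
          simp [root, hiv, hiu, hW i (by simp [hiv, hi])]
    · rw [signedCount_insert_of_neg hv hu hEs (by simpa using h0), if_neg]
      intro h
      have := (hc.1 h).1
      apply h0
      linarith

end GrownTree

/-! ### Every directed tree is grown -/

theorem IsDirectedTree.exists_grownTree {n : ℕ} {E : Finset (Fin n × Fin n)}
    (hE : IsDirectedTree E) (m : ℕ) (hm : m + 1 ≤ n) :
    ∃ W E', GrownTree W E' ∧ E' ⊆ E ∧ W.card = m + 1 := by
  induction m with
  | zero => exact ⟨{⟨0, hm⟩}, ∅, .single _, by simp, by simp⟩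
  | succ m ih =>
    obtain ⟨W, E', hT, hsub, hcard⟩ := ih (by omega)
    obtain ⟨a, ha⟩ : W.Nonempty := Finset.card_pos.1 (by omega)
    obtain ⟨b, hb⟩ : ∃ b, b ∉ W := by
      by_contra! hall
      have : W = Finset.univ := Finset.eq_univ_of_forall hall
      rw [this, Finset.card_univ, Fintype.card_fin] at hcard
      omega
    -- A walk leaving `W` crosses its boundary along an edge, which attaches a new leaf.
    obtain ⟨p⟩ := hE.2.connected.preconnected a b
    obtain ⟨d, -, hd1, hd2⟩ := p.exists_boundary_dart (W : Set (Fin n)) ha hb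
    have hadj := d.adj
    rw [SimpleGraph.fromRel_adj] at hadj
    have hd1 : d.fst ∈ W := hd1
    have hd2 : d.snd ∉ W := hd2
    rcases hadj.2 with h | h
    · exact ⟨_, _, .sink hd2 hd1 hT, Finset.insert_subset h hsub,
        by rw [Finset.card_insert_of_notMem hd2, hcard]⟩
    · exact ⟨_, _, .source hd2 hd1 hT, Finset.insert_subset h hsub,
        by rw [Finset.card_insert_of_notMem hd2, hcard]⟩

/-- Forgetting orientations is injective on `E`, since no edge occurs both ways, and a tree has one
edge fewer than vertices. This bound forces a grown subtree on all vertices to use every edge of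
`E`. -/
theorem IsDirectedTree.card_add_one_le {n : ℕ} {E : Finset (Fin n × Fin n)}
    (hE : IsDirectedTree E) : E.card + 1 ≤ n := by
  classical
  have hT := hE.2.card_edgeFinset
  rw [Fintype.card_fin] at hT
  refine le_of_le_of_eq (Nat.succ_le_succ ?_) hT
  refine Finset.card_le_card_of_injOn (fun e => s(e.1, e.2)) ?_ ?_
  · intro e he
    rw [SetLike.mem_coe, SimpleGraph.mem_edgeFinset, SimpleGraph.mem_edgeSet, SimpleGraph.fromRel_adj]
    refine ⟨fun h => ?_, Or.inl he⟩
    have he' : (e.1, e.2) ∈ E := he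
    have := hE.1 _ _ he'
    rw [h] at this he'
    exact this he'
  · rintro ⟨a, b⟩ he ⟨c, d⟩ hf h
    rcases Sym2.eq_iff.1 h with ⟨h1, h2⟩ | ⟨h1, h2⟩
    · exact Prod.ext h1 h2
    · simp only at h1 h2
      subst h1 h2
      exact absurd hf (hE.1 _ _ he)

theorem IsDirectedTree.grownTree {n : ℕ} {E : Finset (Fin n × Fin n)}
    (hE : IsDirectedTree E) : GrownTree Finset.univ E := by
  have hle := hE.card_add_one_le
  obtain ⟨W, E', hT, hsub, hcard⟩ := hE.exists_grownTree (n - 1) (by omega)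
  have hW : W = Finset.univ := by
    rw [← Finset.card_eq_iff_eq_univ, Fintype.card_fin]; omega
  have := hT.card_add_one
  rw [← Finset.eq_of_subset_of_card_le hsub (by omega), ← hW]
  exact hT

/-! ### Ordered set partitions as flags -/

namespace OrderedSetPartition

variable {n : ℕ} (π : OrderedSetPartition n)

theorem block_unique {i : Fin n} {s t : Fin π.len} (hs : i ∈ π.block s) (ht : i ∈ π.block t) :
    s = t := by
  by_contra h
  exact Finset.disjoint_left.1 (π.disjoint s t h) hs ht

/-- The union of the first `m` blocks. -/
def initial (m : ℕ) : Finset (Fin n) :=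
  Finset.univ.filter fun i => ∃ s : Fin π.len, (s : ℕ) < m ∧ i ∈ π.block s

theorem mem_initial {m : ℕ} {i : Fin n} :
    i ∈ π.initial m ↔ ∃ s : Fin π.len, (s : ℕ) < m ∧ i ∈ π.block s := by
  simp [initial]

theorem initial_zero : π.initial 0 = ∅ := by
  ext i; simp [mem_initial]

theorem initial_len : π.initial π.len = Finset.univ := by
  ext i
  obtain ⟨s, hs⟩ := π.cover i
  simp only [mem_initial, Finset.mem_univ, iff_true]
  exact ⟨s, s.2, hs⟩

theorem initial_succ (s : Fin π.len) : π.initial (s + 1) = π.initial s ∪ π.block s := by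
  ext i
  simp only [mem_initial, Finset.mem_union]
  constructor
  · rintro ⟨t, ht, hi⟩
    rcases Nat.lt_succ_iff_lt_or_eq.1 ht with h | h
    · exact Or.inl ⟨t, h, hi⟩
    · exact Or.inr (Fin.ext h ▸ hi)
  · rintro (⟨t, ht, hi⟩ | hi)
    · exact ⟨t, by omega, hi⟩
    · exact ⟨s, by omega, hi⟩

theorem initial_mono : Monotone π.initial := by
  intro a b h i hi
  obtain ⟨s, hs, hi⟩ := π.mem_initial.1 hi
  exact π.mem_initial.2 ⟨s, hs.trans_le h, hi⟩

theorem initial_ssubset {a b : ℕ} (h : a < b) (hb : b ≤ π.len) : π.initial a ⊂ π.initial b := by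
  refine (Finset.ssubset_iff_of_subset (π.initial_mono h.le)).2 ?_
  obtain ⟨i, hi⟩ := π.nonempty ⟨a, h.trans_le hb⟩
  refine ⟨i, π.mem_initial.2 ⟨_, h, hi⟩, fun h' => ?_⟩
  obtain ⟨s, hs, hi'⟩ := π.mem_initial.1 h'
  have := π.block_unique hi' hi
  rw [this] at hs
  exact lt_irrefl _ hs

theorem mem_block_iff {s : Fin π.len} {i : Fin n} :
    i ∈ π.block s ↔ i ∈ π.initial (s + 1) ∧ i ∉ π.initial s := by
  rw [initial_succ, Finset.mem_union]
  constructor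
  · intro hi
    refine ⟨Or.inr hi, fun h => ?_⟩
    obtain ⟨t, ht, hi'⟩ := π.mem_initial.1 h
    rw [π.block_unique hi' hi] at ht
    exact lt_irrefl _ ht
  · rintro ⟨h | h, h'⟩
    · exact absurd h h'
    · exact h

theorem ext_initial {π ρ : OrderedSetPartition n} (hlen : π.len = ρ.len)
    (h : ∀ m ≤ π.len, π.initial m = ρ.initial m) : π = ρ := by
  refine OrderedSetPartition.ext hlen ?_
  refine Function.hfunext (congrArg Fin hlen) fun s t hst => heq_of_eq ?_
  rw [Fin.heq_ext_iff hlen] at hst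
  ext i
  rw [mem_block_iff, mem_block_iff, ← hst, h _ s.2, h _ s.2.le]

/-- The flag of unions of initial blocks. -/
def flag : Finset (Finset (Fin n)) := (Finset.range (π.len + 1)).image π.initial

theorem mem_flag {F : Finset (Fin n)} : F ∈ π.flag ↔ ∃ m ≤ π.len, π.initial m = F := by
  simp [flag]

theorem card_flag : π.flag.card = π.len + 1 := by
  rw [flag, Finset.card_image_of_injOn, Finset.card_range]
  intro a ha b hb hab
  simp only [Finset.coe_range, Set.mem_Iio, Nat.lt_succ_iff] at ha hb
  rcases lt_trichotomy a b with h | h | h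
  · exact absurd hab (π.initial_ssubset h hb).ne
  · exact h
  · exact absurd hab.symm (π.initial_ssubset h ha).ne

theorem isFlag_flag : IsFlag Finset.univ π.flag where
  subset F _ := Finset.subset_univ F
  empty_mem := π.mem_flag.2 ⟨0, Nat.zero_le _, π.initial_zero⟩
  top_mem := π.mem_flag.2 ⟨_, le_rfl, π.initial_len⟩
  chain F hF G hG := by
    obtain ⟨a, -, rfl⟩ := π.mem_flag.1 hF
    obtain ⟨b, -, rfl⟩ := π.mem_flag.1 hG
    exact (le_total a b).imp (fun h => π.initial_mono h) fun h => π.initial_mono h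

theorem precedes_iff {i j : Fin n} : π.Precedes i j ↔ ∃ F ∈ π.flag, i ∈ F ∧ j ∉ F := by
  constructor
  · rintro ⟨s, t, hst, hi, hj⟩
    refine ⟨_, π.mem_flag.2 ⟨s + 1, s.2, rfl⟩, π.mem_initial.2 ⟨s, by omega, hi⟩, fun h => ?_⟩
    obtain ⟨r, hr, hj'⟩ := π.mem_initial.1 h
    have := π.block_unique hj hj'
    subst this
    omega
  · rintro ⟨F, hF, hi, hj⟩
    obtain ⟨m, -, rfl⟩ := π.mem_flag.1 hF
    obtain ⟨s, hs, hi⟩ := π.mem_initial.1 hi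
    obtain ⟨t, ht⟩ := π.cover j
    refine ⟨s, t, ?_, hi, ht⟩
    by_contra hle
    exact hj (π.mem_initial.2 ⟨t, by omega, ht⟩)

/-- The flag adds only ∅ and the full set to the unions in the definition of the plate, and both
have sum zero. -/
theorem mem_plate_iff {x : Fin n → ℝ} :
    x ∈ π.plate ↔ (∀ F ∈ π.flag, 0 ≤ ∑ i ∈ F, x i) ∧ ∑ i, x i = 0 := by
  refine and_congr_left fun hx => ?_
  have hinit : ∀ m : Fin π.len,
      (Finset.univ.filter (fun s => s ≤ m)).biUnion π.block = π.initial (m + 1) := by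
    intro m
    ext i
    simp only [mem_initial, Finset.mem_biUnion, Finset.mem_filter, Finset.mem_univ, true_and,
      Nat.lt_succ_iff, Fin.le_iff_val_le_val]
  constructor
  · intro h F hF
    obtain ⟨m, hm, rfl⟩ := π.mem_flag.1 hF
    rcases hm.lt_or_eq with hm | rfl
    · cases m with
      | zero => rw [initial_zero, Finset.sum_empty]
      | succ m =>
        have := h ⟨m, by omega⟩ hm
        rwa [hinit] at this
    · rw [initial_len, hx]
  · intro h m _
    rw [hinit]
    exact h _ (π.mem_flag.2 ⟨_, m.2, rfl⟩)

theorem flag_injective : Function.Injective (flag : OrderedSetPartition n → _) := by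
  intro π ρ h
  have hlen : π.len = ρ.len := by
    have := congrArg Finset.card h
    rw [card_flag, card_flag] at this
    omega
  have key : (fun m : Fin (π.len + 1) => π.initial m) =
      fun m : Fin (π.len + 1) => ρ.initial m := by
    -- A strictly increasing enumeration is determined by its range.
    refine (StrictMono.range_inj ?_ ?_).1 ?_
    · exact fun a b hab => π.initial_ssubset hab (Nat.lt_succ_iff.1 b.2)
    · exact fun a b hab => ρ.initial_ssubset hab (hlen ▸ Nat.lt_succ_iff.1 b.2)
    · ext F
      have hF := Finset.ext_iff.1 h F
      rw [mem_flag, mem_flag, ← hlen] at hF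
      simpa [Set.mem_range, Fin.exists_iff, Nat.lt_succ_iff] using hF
  exact ext_initial hlen fun m hm => congrFun key ⟨m, Nat.lt_succ_iff.2 hm⟩

end OrderedSetPartition

theorem IsFlag.exists_strictMono {n : ℕ} {W : Finset (Fin n)} {𝓕 : Finset (Finset (Fin n))}
    (h : IsFlag W 𝓕) {k : ℕ} (hk : 𝓕.card = k + 1) :
    ∃ g : Fin (k + 1) → Finset (Fin n), StrictMono g ∧ ∀ F, F ∈ 𝓕 ↔ ∃ m, g m = F := by
  classical
  have hc : IsChain (· ≤ ·) (𝓕 : Set (Finset (Fin n))) := fun F hF G hG _ => h.chain F hF G hG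
  let _ : LinearOrder (𝓕 : Set (Finset (Fin n))) := hc.linearOrder
  have hcard : Fintype.card (𝓕 : Set (Finset (Fin n))) = k + 1 := by
    rw [← hk]; exact Fintype.card_coe 𝓕
  let e := Fintype.orderIsoFinOfCardEq _ hcard
  refine ⟨fun m => (e m : Finset (Fin n)), fun a b hab => e.strictMono hab,
    fun F => ⟨fun hF => ?_, ?_⟩⟩
  · exact ⟨e.symm ⟨F, hF⟩, by simp⟩
  · rintro ⟨m, rfl⟩
    exact (e m).2

theorem IsFlag.exists_flag_eq {n : ℕ} {𝓕 : Finset (Finset (Fin n))}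
    (h : IsFlag Finset.univ 𝓕) : ∃ π : OrderedSetPartition n, π.flag = 𝓕 := by
  obtain ⟨k, hk⟩ : ∃ k, 𝓕.card = k + 1 :=
    Nat.exists_eq_succ_of_ne_zero (Finset.card_pos.2 ⟨_, h.empty_mem⟩).ne'
  obtain ⟨g, hg, hmem⟩ := h.exists_strictMono hk
  have h0 : g 0 = ∅ := by
    obtain ⟨m, hm⟩ := (hmem ∅).1 h.empty_mem
    exact Finset.subset_empty.1 (hm ▸ hg.monotone (Fin.zero_le m))
  have h1 : g (Fin.last k) = Finset.univ := by
    obtain ⟨m, hm⟩ := (hmem _).1 h.top_mem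
    exact Finset.univ_subset_iff.1 (hm ▸ hg.monotone (Fin.le_last m))
  have hdisj : ∀ s t : Fin k, s < t →
      Disjoint (g s.succ \ g s.castSucc) (g t.succ \ g t.castSucc) := by
    intro s t hst
    rw [Finset.disjoint_left]
    intro i hi hi'
    rw [Finset.mem_sdiff] at hi hi'
    have hle : s.succ ≤ t.castSucc := by
      simpa [Fin.le_iff_val_le_val] using hst
    exact hi'.2 (hg.monotone hle hi.1)
  -- The blocks are the successive differences of the chain.
  let π : OrderedSetPartition n :=
    { len := k
      block := fun s => g s.succ \ g s.castSucc
      nonempty := fun s =>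
        Finset.sdiff_nonempty.2 (hg (Fin.castSucc_lt_succ (i := s))).2
      disjoint := fun s t hst => by
        rcases lt_or_gt_of_ne hst with h | h
        · exact hdisj s t h
        · exact (hdisj t s h).symm
      cover := fun i => by
        by_contra! hall
        have : ∀ m : Fin (k + 1), i ∉ g m := by
          intro m
          induction m using Fin.induction with
          | zero => simp [h0]
          | succ m ih => exact fun hi => hall m (Finset.mem_sdiff.2 ⟨hi, ih⟩)
        exact this (Fin.last k) (by simp [h1]) }
  have hinit : ∀ m : Fin (k + 1), π.initial m = g m := by
    intro m
    induction m using Fin.induction with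
    | zero => rw [h0]; exact π.initial_zero
    | succ m ih =>
      have hsucc := π.initial_succ m
      rw [Fin.val_castSucc] at ih
      rw [ih] at hsucc
      rw [Fin.val_succ, hsucc]
      exact Finset.union_sdiff_of_subset (hg.monotone (Fin.castSucc_le_succ m))
  refine ⟨π, ?_⟩
  ext F
  rw [π.mem_flag, hmem]
  constructor
  · rintro ⟨m, hm, rfl⟩
    exact ⟨⟨m, Nat.lt_succ_iff.2 hm⟩, (hinit ⟨m, Nat.lt_succ_iff.2 hm⟩).symm⟩
  · rintro ⟨m, rfl⟩
    exact ⟨m, Nat.lt_succ_iff.1 m.2, hinit m⟩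

/-! ### From plates to flags, and the conclusion -/

open Classical in
theorem sum_plate_eq_signedCount {n : ℕ} (E : Finset (Fin n × Fin n)) {x : Fin n → ℝ}
    (hx : ∑ i, x i = 0) :
    (∑ π : OrderedSetPartition n with ∀ e ∈ E, π.Precedes e.1 e.2,
      (-1 : ℂ) ^ (n - π.len) * (if x ∈ π.plate then 1 else 0)) =
      (signedCount Finset.univ E x : ℂ) := by
  simp only [mul_ite, mul_one, mul_zero]
  rw [← Finset.sum_filter, Finset.filter_filter, signedCount, Int.cast_sum]
  have hiff : ∀ π : OrderedSetPartition n, π.flag ∈ admissible Finset.univ E x ↔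
      (∀ e ∈ E, π.Precedes e.1 e.2) ∧ x ∈ π.plate := by
    intro π
    simp only [mem_admissible, π.isFlag_flag, true_and, Separates, π.precedes_iff,
      π.mem_plate_iff, hx, and_true]
  refine Finset.sum_bij (fun π _ => π.flag) ?_ ?_ ?_ ?_
  · intro π h
    exact (hiff π).2 (Finset.mem_filter.1 h).2
  · intro π _ ρ _ h
    exact OrderedSetPartition.flag_injective h
  · intro 𝓕 h
    obtain ⟨π, rfl⟩ := (mem_admissible.1 h).1.exists_flag_eq
    exact ⟨π, Finset.mem_filter.2 ⟨Finset.mem_univ _, (hiff π).1 h⟩, rfl⟩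
  · intro π _
    rw [π.card_flag, Finset.card_univ, Fintype.card_fin]
    have hle := π.len_le
    -- The two exponents differ by an even number; `hle` makes the subtraction exact.
    have : n + 1 + (π.len + 1) = (n - π.len) + 2 * (π.len + 1) := by omega
    rw [this, pow_add, pow_mul]
    simp

theorem theorem5p1 (n : ℕ) (E : Finset (Fin n × Fin n)) (hE : IsDirectedTree E) :
    charFn (edgeCone E) ∈ plateSpace n ∧
      charFn (edgeCone E) =
        ∑ π : OrderedSetPartition n with ∀ e ∈ E, π.Precedes e.1 e.2,
          (-1 : ℂ) ^ (n - π.len) • charFn π.plate := by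
  classical
  have key : charFn (edgeCone E) =
      ∑ π : OrderedSetPartition n with ∀ e ∈ E, π.Precedes e.1 e.2,
        (-1 : ℂ) ^ (n - π.len) • charFn π.plate := by
    funext x
    simp only [Finset.sum_apply, Pi.smul_apply, smul_eq_mul, charFn, Set.indicator_apply]
    by_cases hx : ∑ i, x i = 0
    · rw [sum_plate_eq_signedCount E hx, hE.grownTree.signedCount_eq x (by simp) hx]
      split_ifs <;> simp
    -- Off the hyperplane of sum zero, the cone and all plates are empty.
    · rw [if_neg fun h => hx (sum_eq_zero_of_mem_edgeCone h)]
      refine (Finset.sum_eq_zero fun π _ => ?_).symm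
      rw [if_neg fun h => hx h.2, mul_zero]
  refine ⟨?_, key⟩
  rw [key]
  exact Submodule.sum_mem _ fun π _ =>
    Submodule.smul_mem _ _ (Submodule.subset_span (Set.mem_range_self π))
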